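/- **Theorem 3.1.** Let $m$ be Lebesgue measure on $\mathbb{R}^{2n}=\mathbb{R}^n\times\mathbb{R}^n$. For finite complex Borel measures $\mu,\nu$ on $\mathbb{R}^{2n}$, the twisted convolution $\mu\,\natural\,\nu$ is the complex Borel measure $$(\mu\,\natural\,\nu)(E)=\int_{\mathbb{R}^{2n}}\int_{\mathbb{R}^{2n}}\chi_E(x+x',y+y')\,e^{\pi i(x\cdot y'-y\cdot x')}\,d\mu(x,y)\,d\nu(x',y'),\qquad E\subseteq\mathbb{R}^{2n}\ \text{Borel},$$ and $\mu_1\,\natural\cdots\natural\,\mu_k$ denotes $(\cdots(\mu_1\,\natural\,\mu_2)\,\natural\cdots)\,\natural\,\mu_k$. If $M\subseteq\mathbb{R}^{2n}$ is an (embedded) submanifold, a *smooth measure on $M$* is a measure $\mu=\psi\sigma$, where $\sigma$ is the measure on $M$ induced by Lebesgue measure on $\mathbb{R}^{2n}$ (the $(\dim M)$-dimensional surface measure) and $\psi:\mathbb{R}^{2n}\to\mathbb{C}$ is a smooth function whose support intersects $M$ in a compact set. Let $k\ge 1$, and let $M_1,\dots,M_k$ be connected real-analytic submanifolds of $\mathbb{R}^{2n}$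 (of arbitrary, possibly different, dimensions) such that for some choice of points $p_i\in M_i$, $i=1,\dots,k$, $$T_{p_1}M_1+\cdots+T_{p_k}M_k=\mathbb{R}^{2n},$$ where $T_{p_i}M_i$ is the tangent space of $M_i$ at $p_i$. If $\mu_i$ is a smooth measure on $M_i$ for $i=1,\dots,k$, then $\mu_1\,\natural\cdots\natural\,\mu_k$ is absolutely continuous with respect to $m$, i.e. $(\mu_1\,\natural\cdots\natural\,\mu_k)(E)=0$ for every Borel set $E$ with $m(E)=0$. -/

import Mathlib

open MeasureTheory Filter Topology
open scoped ContDiff ENNReal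

namespace TwistedRagozin

/-! ### Integration against products of complex measures

Mathlib's `∫ᵛ x, f x ∂[B; μ]` is the integral of `f` against the vector measure `μ`; with `B` the
multiplication of `ℂ` it is the usual integral of a complex function against a complex measure. -/

/-- A complex measure has finite total variation. -/
theorem variation_lt_top {X : Type*} [MeasurableSpace X] (μ : ComplexMeasure X) :
    IsFiniteMeasure μ.variation := by
  have h : μ.variation ≤ (ComplexMeasure.re μ).totalVariation +
      (ComplexMeasure.im μ).totalVariation := by
    apply VectorMeasure.variation_le_of_forall_enorm_le
    intro s hs
    have h1 := SignedMeasure.enorm_le_totalVariation (ComplexMeasure.re μ) s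
    have h2 := SignedMeasure.enorm_le_totalVariation (ComplexMeasure.im μ) s
    have h3 : ‖μ s‖ₑ ≤ ‖ComplexMeasure.re μ s‖ₑ + ‖ComplexMeasure.im μ s‖ₑ := by
      simp only [← ofReal_norm]
      rw [← ENNReal.ofReal_add (norm_nonneg _) (norm_nonneg _)]
      apply ENNReal.ofReal_le_ofReal
      exact Complex.norm_le_abs_re_add_abs_im (μ s)
    rw [Measure.add_apply]
    exact h3.trans (add_le_add h1 h2)
  exact isFiniteMeasure_of_le _ h

instance {X : Type*} [MeasurableSpace X] (μ : ComplexMeasure X) :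
    IsFiniteMeasure μ.variation := variation_lt_top μ

/-- The product of two complex measures. -/
noncomputable abbrev cprod {X Y : Type*} [MeasurableSpace X] [MeasurableSpace Y]
    (μ : ComplexMeasure X) (ν : ComplexMeasure Y) : ComplexMeasure (X × Y) :=
  μ.prod ν (ContinuousLinearMap.mul ℝ ℂ)

/-- The integral `∫ f dμ` of a complex function against a complex measure. -/
noncomputable abbrev cintegral {X : Type*} [MeasurableSpace X]
    (μ : ComplexMeasure X) (f : X → ℂ) : ℂ :=
  ∫ᵛ x, f x ∂[ContinuousLinearMap.mul ℝ ℂ; μ]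

theorem cprod_apply {X Y : Type*} [MeasurableSpace X] [MeasurableSpace Y]
    (μ : ComplexMeasure X) (ν : ComplexMeasure Y) {s : Set (X × Y)} (hs : MeasurableSet s) :
    cprod μ ν s = cintegral ν fun y => μ ((fun x => (x, y)) ⁻¹' s) := by
  have h : cprod μ ν = (cprod ν μ).map Prod.swap := by
    apply VectorMeasure.prod_eq_of_forall_apply_prod
    intro a b ha hb
    rw [VectorMeasure.map_apply _ measurable_swap (ha.prod hb)]
    simp [mul_comm]
  have hf : (ContinuousLinearMap.mul ℝ ℂ).flip = ContinuousLinearMap.mul ℝ ℂ := by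
    ext
    simp
  rw [h, VectorMeasure.map_apply _ measurable_swap hs,
    VectorMeasure.prod_apply_eq_integral (measurable_swap hs), hf]
  rfl

theorem cintegral_bound {X : Type*} [MeasurableSpace X] (μ : ComplexMeasure X) (C : ℝ) :
    ∃ D : ℝ, ∀ f : X → ℂ, (∀ x, ‖f x‖ ≤ C) → ‖cintegral μ f‖ ≤ D := by
  refine ⟨_, fun f hf => VectorMeasure.norm_integral_le_of_norm_le_const
    (μ := μ) (B := ContinuousLinearMap.mul ℝ ℂ) (C := C) (Eventually.of_forall hf)⟩

theorem cintegral_tendsto {X : Type*} [MeasurableSpace X] (μ : ComplexMeasure X) {C : ℝ}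
    {F : ℕ → X → ℂ} {f : X → ℂ} (hm : ∀ n, StronglyMeasurable (F n))
    (hb : ∀ n x, ‖F n x‖ ≤ C) (hl : ∀ x, Tendsto (fun n => F n x) atTop (𝓝 (f x))) :
    Tendsto (fun n => cintegral μ (F n)) atTop (𝓝 (cintegral μ f)) :=
  VectorMeasure.tendsto_integral_filter_of_norm_le_const
    (Eventually.of_forall fun n => (hm n).aestronglyMeasurable)
    ⟨C, Eventually.of_forall fun n => Eventually.of_forall (hb n)⟩ (Eventually.of_forall hl)

/-- Fubini's theorem for bounded measurable functions and complex measures. -/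
theorem cintegral_cprod {X Y : Type*} [MeasurableSpace X] [MeasurableSpace Y]
    (μ : ComplexMeasure X) (ν : ComplexMeasure Y) {f : X × Y → ℂ} (hf : StronglyMeasurable f)
    {C : ℝ} (hC : ∀ z, ‖f z‖ ≤ C) :
    cintegral (cprod μ ν) f = cintegral ν fun y => cintegral μ fun x => f (x, y) := by
  have sec : ∀ {g : X × Y → ℂ} (_ : StronglyMeasurable g) (y : Y),
      StronglyMeasurable fun x => g (x, y) :=
    fun hg y => hg.comp_measurable measurable_prodMk_right
  have key : ∀ g : SimpleFunc (X × Y) ℂ,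
      StronglyMeasurable (fun y => cintegral μ fun x => g (x, y)) ∧
      cintegral (cprod μ ν) g = cintegral ν fun y => cintegral μ fun x => g (x, y) := by
    intro g
    induction g using SimpleFunc.induction with
    | const c hs =>
      rename_i s
      have h1 : ⇑(SimpleFunc.piecewise s hs (SimpleFunc.const _ c) (SimpleFunc.const _ 0)) =
          s.indicator fun _ => c := by
        ext z
        simp [Set.indicator, Set.piecewise]
      have h2 : ∀ y : Y, (cintegral μ fun x => s.indicator (fun _ => c) (x, y)) =
          c * μ ((fun x => (x, y)) ⁻¹' s) := by
        intro y
        have hy : MeasurableSet ((fun x => (x, y)) ⁻¹' s) := measurable_prodMk_right hs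
        have h := VectorMeasure.integral_indicator_const (μ := μ)
          (B := ContinuousLinearMap.mul ℝ ℂ) (s := (fun x => (x, y)) ⁻¹' s) c hy
        exact h
      have h3 : StronglyMeasurable fun y => μ ((fun x => (x, y)) ⁻¹' s) :=
        VectorMeasure.stronglyMeasurable_vectorMeasure_prodMk_left (ν := μ) (measurable_swap hs)
      rw [h1]
      simp only [h2]
      refine ⟨h3.const_mul c, ?_⟩
      rw [cintegral, VectorMeasure.integral_indicator_const _ hs]
      change c * cprod μ ν s = _
      rw [cprod_apply μ ν hs]
      have h4 := VectorMeasure.continuousLinearMap_apply_integral (μ := ν)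
        (B := ContinuousLinearMap.mul ℝ ℂ) (C := ContinuousLinearMap.mul ℝ ℂ c)
        (f := fun y => μ ((fun x => (x, y)) ⁻¹' s))
        (Integrable.of_bound h3.aestronglyMeasurable μ.bound
          (Eventually.of_forall fun y => VectorMeasure.norm_apply_le_bound))
      have h5 := VectorMeasure.integral_continuousLinearMap_comp (μ := ν)
        (B := ContinuousLinearMap.mul ℝ ℂ) (C := ContinuousLinearMap.mul ℝ ℂ c)
        (f := fun y => μ ((fun x => (x, y)) ⁻¹' s))
        (Integrable.of_bound h3.aestronglyMeasurable μ.bound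
          (Eventually.of_forall fun y => VectorMeasure.norm_apply_le_bound))
      simp only [ContinuousLinearMap.mul_apply'] at h4 h5
      rw [cintegral, cintegral, h4, h5]
      congr 1
      ext
      simp [mul_assoc]
    | add _ hf hg =>
      rename_i f g _
      obtain ⟨Cf, hCf⟩ := f.exists_forall_norm_le
      obtain ⟨Cg, hCg⟩ := g.exists_forall_norm_le
      have i1 : ∀ y, VectorMeasure.Integrable μ fun x => f (x, y) := fun y =>
        Integrable.of_bound (sec f.stronglyMeasurable y).aestronglyMeasurable Cf
          (Eventually.of_forall fun x => hCf _)
      have i2 : ∀ y, VectorMeasure.Integrable μ fun x => g (x, y) := fun y =>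
        Integrable.of_bound (sec g.stronglyMeasurable y).aestronglyMeasurable Cg
          (Eventually.of_forall fun x => hCg _)
      have h1 : ∀ y, (cintegral μ fun x => (f + g) (x, y)) =
          (cintegral μ fun x => f (x, y)) + cintegral μ fun x => g (x, y) := fun y =>
        VectorMeasure.integral_fun_add (i1 y) (i2 y)
      simp only [h1]
      refine ⟨hf.1.add hg.1, ?_⟩
      rw [SimpleFunc.coe_add]
      have b : ∀ h : SimpleFunc (X × Y) ℂ,
          StronglyMeasurable (fun y => cintegral μ fun x => h (x, y)) →
          VectorMeasure.Integrable ν fun y => cintegral μ fun x => h (x, y) := by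
        intro h hh
        obtain ⟨Ch, hCh⟩ := h.exists_forall_norm_le
        obtain ⟨D, hD⟩ := cintegral_bound μ Ch
        exact Integrable.of_bound hh.aestronglyMeasurable D (Eventually.of_forall fun y =>
          hD _ fun x => hCh _)
      have e1 : cintegral ν (fun y => (cintegral μ fun x => f (x, y)) +
          cintegral μ fun x => g (x, y)) = _ :=
        VectorMeasure.integral_fun_add (b f hf.1) (b g hg.1)
      have e2 : cintegral (cprod μ ν) (⇑f + ⇑g) = _ :=
        VectorMeasure.integral_add f.integrable_of_isFiniteMeasure g.integrable_of_isFiniteMeasure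
      rw [e1, e2]
      exact congrArg₂ (· + ·) hf.2 hg.2
  have hC' : ∀ z, ‖f z‖ ≤ max C 0 := fun z => (hC z).trans (le_max_left _ _)
  have ha := fun n z => hf.norm_approxBounded_le (le_max_right C 0) n z
  have hl := fun z => hf.tendsto_approxBounded_of_norm_le (hC' z)
  have hin : ∀ y, Tendsto (fun n => cintegral μ fun x => hf.approxBounded (max C 0) n (x, y)) atTop
      (𝓝 (cintegral μ fun x => f (x, y))) := fun y =>
    cintegral_tendsto μ (fun n => sec (SimpleFunc.stronglyMeasurable _) y) (fun n x => ha n _)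
      fun x => hl _
  obtain ⟨D, hD⟩ := cintegral_bound μ (max C 0)
  have t1 := cintegral_tendsto ν (fun n => (key (hf.approxBounded (max C 0) n)).1)
    (fun n y => hD _ fun x => ha n _) hin
  have t2 := cintegral_tendsto (cprod μ ν)
    (fun n => (hf.approxBounded (max C 0) n).stronglyMeasurable) ha hl
  refine tendsto_nhds_unique t2 (t1.congr fun n => ?_)
  exact (key _).2.symm

/-! ### Twisted convolution -/

/-- The space `ℝ²ⁿ = ℝⁿ × ℝⁿ` with its Euclidean structure; the coordinates indexed by `Sum.inl i`
are those of `x`, the coordinates indexed by `Sum.inr i` those of `y`, in a point `(x, y)`. -/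
abbrev PhaseSpace (n : ℕ) : Type := EuclideanSpace ℝ (Fin n ⊕ Fin n)

/-- The symplectic form `x ⬝ y' - y ⬝ x'` at the points `p = (x, y)` and `q = (x', y')`. -/
def symplecticForm {n : ℕ} (p q : PhaseSpace n) : ℝ :=
  ∑ i, (p (Sum.inl i) * q (Sum.inr i) - p (Sum.inr i) * q (Sum.inl i))

/-- The phase factor `exp (π i (x ⬝ y' - y ⬝ x'))`. -/
noncomputable def twist {n : ℕ} (p q : PhaseSpace n) : ℂ :=
  Complex.exp (Real.pi * Complex.I * symplecticForm p q)

theorem norm_twist {n : ℕ} (p q : PhaseSpace n) : ‖twist p q‖ = 1 := by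
  have h : (Real.pi * Complex.I * symplecticForm p q : ℂ) =
      ((Real.pi * symplecticForm p q : ℝ) : ℂ) * Complex.I := by
    push_cast
    ring
  rw [twist, h, Complex.norm_exp_ofReal_mul_I]

theorem continuous_twist {n : ℕ} :
    Continuous fun z : PhaseSpace n × PhaseSpace n => twist z.1 z.2 := by
  unfold twist symplecticForm
  fun_prop

theorem integrable_twist {n : ℕ} (ρ : ComplexMeasure (PhaseSpace n × PhaseSpace n)) :
    VectorMeasure.Integrable ρ fun z => twist z.1 z.2 :=
  Integrable.of_bound continuous_twist.stronglyMeasurable.aestronglyMeasurable 1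
    (Eventually.of_forall fun z => (norm_twist z.1 z.2).le)

/-- The push-forward of the product measure, weighted by the phase factor, under addition. -/
noncomputable def twistedPush {n : ℕ} (μ ν : ComplexMeasure (PhaseSpace n)) :
    ComplexMeasure (PhaseSpace n) :=
  ((cprod μ ν).withDensity (fun z => twist z.1 z.2) (ContinuousLinearMap.mul ℝ ℂ)).map
    fun z => z.1 + z.2

theorem twistedPush_apply {n : ℕ} (μ ν : ComplexMeasure (PhaseSpace n))
    {A : Set (PhaseSpace n)} (hA : MeasurableSet A) :
    twistedPush μ ν A = cintegral ν fun q => cintegral μ fun p =>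
      A.indicator (fun _ => (1 : ℂ)) (p + q) * twist p q := by
  have hm : Measurable fun z : PhaseSpace n × PhaseSpace n => z.1 + z.2 := by fun_prop
  rw [twistedPush, VectorMeasure.map_apply _ hm hA,
    VectorMeasure.withDensity_apply (integrable_twist _),
    ← VectorMeasure.integral_indicator (hm hA)]
  have h := cintegral_cprod μ ν
    (f := ((fun z => z.1 + z.2) ⁻¹' A).indicator fun z => twist z.1 z.2)
    (continuous_twist.stronglyMeasurable.indicator (hm hA)) (C := 1) (fun z => by
      refine (norm_indicator_le_norm_self _ _).trans (norm_twist z.1 z.2).le)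
  refine h.trans ?_
  congr 1
  ext q
  congr 1
  ext p
  by_cases hp : p + q ∈ A <;> simp [Set.indicator, hp]

open Classical in
/-- The twisted convolution `μ ♮ ν` of two complex Borel measures on `ℝ²ⁿ`:
`(μ ♮ ν)(A) = ∫ ∫ χ_A(x + x', y + y') exp (π i (x ⬝ y' - y ⬝ x')) dμ(x, y) dν(x', y')`. -/
noncomputable def twistedConv {n : ℕ} (μ ν : ComplexMeasure (PhaseSpace n)) :
    ComplexMeasure (PhaseSpace n) where
  measureOf' A :=
    if MeasurableSet A then
      cintegral ν fun q => cintegral μ fun p =>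
        A.indicator (fun _ => (1 : ℂ)) (p + q) * twist p q
    else 0
  empty' := by
    rw [if_pos MeasurableSet.empty, ← twistedPush_apply μ ν MeasurableSet.empty]
    exact VectorMeasure.empty _
  not_measurable' A hA := if_neg hA
  m_iUnion' f hf hd := by
    simp only [hf, MeasurableSet.iUnion hf, if_true]
    simp only [← twistedPush_apply μ ν (hf _), ← twistedPush_apply μ ν (MeasurableSet.iUnion hf)]
    exact (twistedPush μ ν).m_iUnion hf hd

theorem twistedConv_eq_twistedPush {n : ℕ} (μ ν : ComplexMeasure (PhaseSpace n)) :
    twistedConv μ ν = twistedPush μ ν := by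
  ext A hA
  rw [twistedPush_apply μ ν hA]
  exact if_pos hA

/-- The iterated twisted convolution `(⋯ (μ 0 ♮ μ 1) ♮ ⋯) ♮ μ k`. -/
noncomputable def iterTwistedConv {n : ℕ} :
    (k : ℕ) → (Fin (k + 1) → ComplexMeasure (PhaseSpace n)) → ComplexMeasure (PhaseSpace n)
  | 0, μ => μ 0
  | k + 1, μ => twistedConv (iterTwistedConv k fun i => μ i.castSucc) (μ (Fin.last (k + 1)))

/-! ### Submanifolds and smooth measures -/

/-- `M` is a `d`-dimensional (embedded) real-analytic submanifold of `V`: around each of its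
points there is a real-analytic change of coordinates, defined on an open subset of `V`, with
real-analytic inverse, which carries `M` to a `d`-dimensional linear subspace. -/
def IsAnalyticSubmanifold {V : Type*} [NormedAddCommGroup V] [NormedSpace ℝ V]
    (d : ℕ) (M : Set V) : Prop :=
  ∀ p ∈ M, ∃ (Φ : OpenPartialHomeomorph V V) (W : Submodule ℝ V),
    p ∈ Φ.source ∧ AnalyticOnNhd ℝ Φ Φ.source ∧ AnalyticOnNhd ℝ Φ.symm Φ.target ∧
    Module.finrank ℝ W = d ∧ Φ.IsImage M (W : Set V)

/-- The tangent space of `M` at `p`: the space (spanned by) the velocities at `p` of the smooth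
curves in `M` through `p`. -/
def tangentSpaceAt {V : Type*} [NormedAddCommGroup V] [NormedSpace ℝ V]
    (M : Set V) (p : V) : Submodule ℝ V :=
  Submodule.span ℝ {v | ∃ γ : ℝ → V, ContDiffAt ℝ ∞ γ 0 ∧ (∀ᶠ t in 𝓝 0, γ t ∈ M) ∧
    γ 0 = p ∧ deriv γ 0 = v}

/-- The measure on a `d`-dimensional submanifold `M` of a Euclidean space induced by Lebesgue
measure, as a measure on the ambient space: the `d`-dimensional Hausdorff measure, normalized so
that it is Lebesgue measure on `ℝᵈ`, restricted to `M`. -/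
noncomputable def inducedMeasure {n : ℕ} (d : ℕ) (M : Set (PhaseSpace n)) :
    Measure (PhaseSpace n) :=
  (Measure.euclideanHausdorffMeasure d).restrict M

/-- The induced measure is finite on the compact subsets of a submanifold. -/
theorem inducedMeasure_lt_top {n d : ℕ} {M K : Set (PhaseSpace n)}
    (hM : IsAnalyticSubmanifold d M) (hKM : K ⊆ M) (hK : IsCompact K) :
    inducedMeasure d M K < ⊤ := by
  refine hK.induction_on (p := fun s => inducedMeasure d M s < ⊤) (by simp)
    (fun s t hst ht => (measure_mono hst).trans_lt ht)
    (fun s t hs ht => (measure_union_le s t).trans_lt (ENNReal.add_lt_top.2 ⟨hs, ht⟩)) ?_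
  intro p hp
  obtain ⟨Φ, W, hpΦ, -, hsymm, hW, himg⟩ := hM p (hKM hp)
  obtain ⟨L, t, ht, hL⟩ :=
    ((hsymm (Φ p) (Φ.map_source hpΦ)).contDiffAt (n := 1)).exists_lipschitzOnWith
  obtain ⟨r, hr, hrt⟩ := Metric.mem_nhds_iff.1 ht
  have hU : Φ.source ∩ Φ ⁻¹' Metric.ball (Φ p) r ∈ 𝓝 p :=
    inter_mem (Φ.open_source.mem_nhds hpΦ)
      ((Φ.continuousAt hpΦ).preimage_mem_nhds (Metric.ball_mem_nhds _ hr))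
  refine ⟨_, mem_nhdsWithin_of_mem_nhds hU, ?_⟩
  have hms : MeasurableSet (Φ.source ∩ Φ ⁻¹' Metric.ball (Φ p) r) :=
    (Φ.isOpen_inter_preimage Metric.isOpen_ball).measurableSet
  let B : Set W := Subtype.val ⁻¹' Metric.ball (Φ p) r
  have hsub : Φ.source ∩ Φ ⁻¹' Metric.ball (Φ p) r ∩ M ⊆ Φ.symm '' (Subtype.val '' B) := by
    rintro x ⟨⟨hx, hxb⟩, hxM⟩
    exact ⟨Φ x, ⟨⟨Φ x, (himg hx).2 hxM⟩, hxb, rfl⟩, Φ.left_inv hx⟩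
  have hBt : Subtype.val '' B ⊆ t := by
    rintro _ ⟨x, hx, rfl⟩
    exact hrt hx
  have hBfin : (Measure.euclideanHausdorffMeasure d : Measure W) B < ⊤ := by
    subst hW
    have hBb : Bornology.IsBounded B := by
      refine (Metric.isBounded_iff_subset_closedBall (0 : W)).2 ⟨‖Φ p‖ + r, fun x hx => ?_⟩
      have h1 : dist (x : PhaseSpace n) (Φ p) < r := hx
      rw [mem_closedBall_zero_iff, Submodule.coe_norm]
      have h2 := norm_sub_norm_le (x : PhaseSpace n) (Φ p)
      rw [← dist_eq_norm] at h2
      linarith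
    exact hBb.measure_lt_top
  rw [Measure.euclideanHausdorffMeasure_def, Measure.smul_apply] at hBfin
  have hc := Measure.addHaarScalarFactor_volume_hausdorffMeasure_ne_zero d
  have hBfin' : (Measure.hausdorffMeasure d : Measure W) B < ⊤ := by
    rw [ENNReal.smul_def, smul_eq_mul] at hBfin
    by_contra hcon
    rw [not_lt, top_le_iff] at hcon
    rw [hcon, ENNReal.mul_top (by simpa using hc)] at hBfin
    exact lt_irrefl _ hBfin
  rw [inducedMeasure, Measure.restrict_apply hms, Measure.euclideanHausdorffMeasure_def,
    Measure.smul_apply, ENNReal.smul_def, smul_eq_mul]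
  refine ENNReal.mul_lt_top (by simp) ?_
  refine (measure_mono hsub).trans_lt ?_
  refine ((hL.mono hBt).hausdorffMeasure_image_le (by positivity)).trans_lt ?_
  have hiso : Isometry (Subtype.val : W → PhaseSpace n) := isometry_subtype_coe
  rw [hiso.hausdorffMeasure_image (Or.inl (by positivity))]
  exact ENNReal.mul_lt_top (ENNReal.rpow_lt_top_of_nonneg (by positivity) (by simp)) hBfin'

/-- The densities of smooth measures are integrable. -/
theorem integrable_density {n d : ℕ} {M : Set (PhaseSpace n)}
    (hM : IsAnalyticSubmanifold d M) {ψ : PhaseSpace n → ℂ} (hψ : ContDiff ℝ ∞ ψ)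
    (hc : IsCompact (tsupport ψ ∩ M)) : Integrable ψ (inducedMeasure d M) := by
  obtain ⟨C, hC⟩ := hc.exists_bound_of_continuousOn hψ.continuous.continuousOn
  have h1 : IntegrableOn ψ (tsupport ψ ∩ M) (inducedMeasure d M) :=
    Measure.integrableOn_of_bounded (M := C)
      (inducedMeasure_lt_top hM Set.inter_subset_right hc).ne
      hψ.continuous.aestronglyMeasurable ((ae_restrict_iff' hc.measurableSet).2
        (Eventually.of_forall hC))
  have h2 : IntegrableOn ψ (tsupport ψ) (inducedMeasure d M) := by
    have h3 : (inducedMeasure d M).restrict (tsupport ψ) =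
        (inducedMeasure d M).restrict (tsupport ψ ∩ M) := by
      rw [inducedMeasure, Measure.restrict_restrict (isClosed_tsupport ψ).measurableSet,
        Measure.restrict_restrict hc.measurableSet, Set.inter_assoc, Set.inter_self]
    rw [IntegrableOn, h3]
    exact h1
  refine (integrableOn_iff_integrable_of_support_subset (subset_tsupport ψ)).1 h2

/-- `μ` is a smooth measure on the `d`-dimensional submanifold `M`: `μ = ψ σ`, where `σ` is the
measure on `M` induced by Lebesgue measure and `ψ` is a smooth function on the ambient space whose
support meets `M` in a compact set. -/
def IsSmoothMeasureOn {n : ℕ} (d : ℕ) (M : Set (PhaseSpace n))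
    (μ : ComplexMeasure (PhaseSpace n)) : Prop :=
  ∃ ψ : PhaseSpace n → ℂ, ContDiff ℝ ∞ ψ ∧ IsCompact (tsupport ψ ∩ M) ∧
    μ = (inducedMeasure d M).withDensityᵥ ψ

end TwistedRagozin

/-!
The phase factor has modulus one, so it does not affect null sets: the iterated twisted convolution
vanishes on a Borel set `A` as soon as the product of positive measures `ρ i` dominating the `μ i`
gives measure zero to the set of tuples `(x i)` with `∑ i, x i ∈ A`
(`iterTwistedConv_apply_eq_zero`). For `ρ i` the surface measure of `M i` on the compact set where
the density lives is a possible choice (`IsSmoothMeasureOn.exists_dominating_measure`). It remains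
to see that the sum map `∏ i, M i → ℝ²ⁿ` pulls Lebesgue null sets back to null sets
(`measure_pi_sum_mem_eq_zero`).

In local analytic coordinates the range of the derivative of the sum map is the sum of the tangent
spaces (`surjective_fderiv_sumMap_iff`). An analytic map on a convex open set which is a submersion
at one point is a submersion almost everywhere (`ae_surjective_fderiv`), because a nonzero analytic
function has a null zero set (`ae_ne_zero_of_analyticOnNhd`), and a submersion locally pulls null
sets back to null sets (`exists_mem_nhds_measure_inter_preimage_eq_zero`). So the claim holds in
every product chart which contains a point where the tangent spaces span. Every chart does: the
spanning condition holds at one point of `∏ i, M i`, and as this product is connected and each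
chart has it densely or nowhere, it holds on a dense set
(`frequently_iSup_tangentSpaceAt_eq_top_of_isConnected`). Lebesgue null sets in the
coordinates are null for the surface measures since the parametrizations are locally Lipschitz
(`exists_localParametrization`).
-/

namespace TwistedRagozin

/-! ### Zero sets of analytic functions, and submersions -/

/-- A real-analytic function on a convex open set which is not identically zero has a null zero
set. On each line through a point `x₀` where it does not vanish its zeros are isolated, so Fubini's
theorem for the map `(x, t) ↦ x₀ + t • x` shows that almost every dilation centred at `x₀` pulls
the zero set back to a null set. -/
theorem ae_ne_zero_of_analyticOnNhd {E : Type*} [NormedAddCommGroup E] [NormedSpace ℝ E]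
    [FiniteDimensional ℝ E] [MeasurableSpace E] [BorelSpace E] (μ : Measure E)
    [μ.IsAddHaarMeasure] {f : E → ℝ} {U : Set E} (hU : IsOpen U) (hUc : Convex ℝ U)
    (hf : AnalyticOnNhd ℝ f U) {x₀ : E} (hx₀ : x₀ ∈ U) (hfx : f x₀ ≠ 0) :
    ∀ᵐ x ∂μ, x ∈ U → f x ≠ 0 := by
  -- the zero set is relatively closed in the open set `U`, hence measurable
  have hZ : MeasurableSet {x | x ∈ U ∧ f x = 0} := by
    have h := hf.continuousOn.isOpen_inter_preimage hU (isOpen_compl_singleton (x := (0 : ℝ)))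
    have h2 : {x | x ∈ U ∧ f x = 0} = U \ (U ∩ f ⁻¹' {0}ᶜ) := by
      ext x
      simp only [Set.mem_ofPred_eq, Set.mem_sdiff, Set.mem_inter_iff, Set.mem_preimage,
        Set.mem_compl_iff, Set.mem_singleton_iff]
      tauto
    rw [h2]
    exact hU.measurableSet.diff h.measurableSet
  have hline : ∀ x : E, ∀ᵐ t : ℝ, x₀ + t • x ∉ {x | x ∈ U ∧ f x = 0} := by
    intro x
    let γ : ℝ →ᵃ[ℝ] E := AffineMap.lineMap x₀ (x₀ + x)
    have hγ : ∀ t, γ t = x₀ + t • x := fun t => by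
      simp [γ, AffineMap.lineMap_apply, add_comm]
    have hγa : ∀ t, AnalyticAt ℝ (fun t : ℝ => x₀ + t • x) t := fun t => by fun_prop
    let T : Set ℝ := (fun t : ℝ => x₀ + t • x) ⁻¹' U
    have hTo : IsOpen T := hU.preimage (by fun_prop)
    have hTc : Convex ℝ T := by
      have := hUc.affine_preimage γ
      have h2 : (γ : ℝ → E) = fun t : ℝ => x₀ + t • x := funext hγ
      rwa [h2] at this
    have hgan : AnalyticOnNhd ℝ (fun t : ℝ => f (x₀ + t • x)) T := fun t ht =>
      AnalyticAt.comp (g := f) (f := fun t : ℝ => x₀ + t • x) (hf _ ht) (hγa t)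
    have h0T : (0 : ℝ) ∈ T := by simpa [T] using hx₀
    rcases hgan.eqOn_zero_or_eventually_ne_zero_of_preconnected hTc.isPreconnected with h | h
    · exact absurd (by simpa using h h0T) hfx
    · have h2 := ae_restrict_le_codiscreteWithin (μ := volume) hTo.measurableSet h
      have h3 : ∀ᵐ t ∂(volume.restrict T), f (x₀ + t • x) ≠ 0 := h2
      rw [ae_restrict_iff' hTo.measurableSet] at h3
      filter_upwards [h3] with t ht hz
      exact ht hz.1 hz.2
  have hm : Measurable fun p : E × ℝ => x₀ + p.2 • p.1 := by fun_prop
  have hswap : ∀ᵐ t : ℝ, ∀ᵐ x ∂μ, x₀ + t • x ∉ {x | x ∈ U ∧ f x = 0} :=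
    (Measure.ae_ae_comm (p := fun x (t : ℝ) => x₀ + t • x ∉ {x | x ∈ U ∧ f x = 0})
      (hm hZ.compl)).1 (Eventually.of_forall hline)
  -- some dilation centred at `x₀`, with nonzero ratio, pulls the zero set back to a null set
  have hne : ∀ᵐ t : ℝ, t ≠ 0 := by simp [ae_iff]
  obtain ⟨t, ht, ht0⟩ := (hswap.and hne).exists
  have h1 : μ ((fun x => x₀ + t • x) ⁻¹' {x | x ∈ U ∧ f x = 0}) = 0 := by
    simpa [ae_iff] using ht
  have h2 : μ ((fun y => x₀ + y) ⁻¹' {x | x ∈ U ∧ f x = 0}) = 0 := by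
    have h3 : (fun x => x₀ + t • x) ⁻¹' {x | x ∈ U ∧ f x = 0} =
      (fun x => t • x) ⁻¹' ((fun y => x₀ + y) ⁻¹' {x | x ∈ U ∧ f x = 0}) := rfl
    rw [h3, Measure.addHaar_preimage_smul μ ht0] at h1
    refine (mul_eq_zero.1 h1).resolve_left ?_
    simpa using pow_pos (abs_pos.2 ht0) _
  rw [measure_preimage_add] at h2
  rw [ae_iff]
  simpa using h2

section Submersion

variable {E V : Type*} [NormedAddCommGroup E] [NormedSpace ℝ E]
  [FiniteDimensional ℝ E] [MeasurableSpace E] [BorelSpace E]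
  [NormedAddCommGroup V] [NormedSpace ℝ V] [FiniteDimensional ℝ V]

/-- Near a point where its derivative `L` is surjective, a `C¹` map `F` pulls null sets back to
null sets: with a right inverse `R` of `L`, the map `G y = y + R (F y - L y)` is a local
diffeomorphism of the source, and `F = L ∘ G`. -/
theorem exists_mem_nhds_measure_inter_preimage_eq_zero [MeasurableSpace V] [BorelSpace V]
    (μ : Measure E) [μ.IsAddHaarMeasure] (ν : Measure V) [ν.IsAddHaarMeasure]
    {F : E → V} {L : E →L[ℝ] V} {x : E}
    (hF : ContDiffAt ℝ 1 F x) (hL : HasFDerivAt F L x) (hsurj : Function.Surjective L)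
    {N : Set V} (hN : ν N = 0) :
    ∃ u ∈ 𝓝 x, μ (u ∩ F ⁻¹' N) = 0 := by
  obtain ⟨R, hR⟩ := L.exists_rightInverse_of_surjective (LinearMap.range_eq_top.2 hsurj)
  have hR' : ∀ v, L (R v) = v := fun v => by simpa using congrArg (fun T => T v) hR
  let G : E → E := fun y => y + R (F y - L y)
  have hLG : ∀ y, L (G y) = F y := fun y => by simp [G, hR']
  have hG : ContDiffAt ℝ 1 G x := by
    have := R.contDiff (n := 1)
    have := L.contDiff (n := 1)
    fun_prop
  have hG' : HasFDerivAt G ((ContinuousLinearEquiv.refl ℝ E : E ≃L[ℝ] E) : E →L[ℝ] E) x := by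
    have h := (hasFDerivAt_id x).add (R.hasFDerivAt.comp x (hL.sub L.hasFDerivAt))
    refine h.congr_fderiv ?_
    ext; simp
  let e := hG.toOpenPartialHomeomorph G hG' one_ne_zero
  have he : (e : E → E) = G := rfl
  have hxe : x ∈ e.source := hG.mem_toOpenPartialHomeomorph_source hG' one_ne_zero
  have hinv : ContDiffAt ℝ 1 e.symm (G x) := by
    have := hG.to_localInverse hG' one_ne_zero
    exact this
  have hd : ∀ᶠ z in 𝓝 (G x), DifferentiableAt ℝ e.symm z :=
    (hinv.eventually (by simp)).mono fun z hz => hz.differentiableAt one_ne_zero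
  refine ⟨e.source ∩ G ⁻¹' {z | DifferentiableAt ℝ e.symm z},
    inter_mem (e.open_source.mem_nhds hxe) (hG.continuousAt hd), ?_⟩
  have hN0 : μ (L ⁻¹' N) = 0 := by
    have h1 := (ae_comp_linearMap_mem_iff (μ := μ) (ν := ν) (L := (L : E →ₗ[ℝ] V)) hsurj
      (measurableSet_toMeasurable ν N).compl).2 (by
        rw [ae_iff]; simpa using hN)
    rw [ae_iff] at h1
    refine measure_mono_null ?_ h1
    intro y hy
    simpa using subset_toMeasurable ν N hy
  have hsub : e.source ∩ G ⁻¹' {z | DifferentiableAt ℝ e.symm z} ∩ F ⁻¹' N ⊆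
      e.symm '' ({z | DifferentiableAt ℝ e.symm z} ∩ L ⁻¹' N) := by
    rintro y ⟨⟨hy, hyd⟩, hyN⟩
    refine ⟨G y, ⟨hyd, ?_⟩, e.left_inv hy⟩
    change L (G y) ∈ N
    rwa [hLG]
  refine measure_mono_null hsub ?_
  refine addHaar_image_eq_zero_of_differentiableOn_of_addHaar_eq_zero μ
    (fun z hz => hz.1.differentiableWithinAt) (measure_mono_null Set.inter_subset_right hN0)

/-- The critical points of an analytic map which is a submersion at one point `x₀` form a null
set: they are among the zeros of `x ↦ det (DF(x) ∘ R)`, where `R` is a right inverse of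
`DF(x₀)`. -/
theorem ae_surjective_fderiv (μ : Measure E) [μ.IsAddHaarMeasure] {F : E → V} {U : Set E}
    (hU : IsOpen U) (hUc : Convex ℝ U) (hF : AnalyticOnNhd ℝ F U) {x₀ : E} (hx₀ : x₀ ∈ U)
    (hsurj : Function.Surjective (fderiv ℝ F x₀)) :
    ∀ᵐ x ∂μ, x ∈ U → Function.Surjective (fderiv ℝ F x) := by
  obtain ⟨R, hR⟩ := (fderiv ℝ F x₀).exists_rightInverse_of_surjective
    (LinearMap.range_eq_top.2 hsurj)
  let b := Module.finBasis ℝ V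
  let T : E → Matrix _ _ ℝ := fun x => LinearMap.toMatrix b b ((fderiv ℝ F x).comp R).toLinearMap
  have hT : ∀ i j, AnalyticOnNhd ℝ (fun x => T x i j) U := by
    intro i j
    let ℓ : (E →L[ℝ] V) →ₗ[ℝ] ℝ :=
      { toFun := fun A => b.repr (A (R (b j))) i
        map_add' := by intro A B; simp
        map_smul' := by intro c A; simp }
    have h1 : (fun x => T x i j) = fun x => (LinearMap.toContinuousLinearMap ℓ) (fderiv ℝ F x) := by
      ext x
      simp [T, ℓ, LinearMap.toMatrix_apply]
    rw [h1]
    exact (ContinuousLinearMap.analyticOnNhd _ Set.univ).comp hF.fderiv (Set.mapsTo_univ _ _)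
  have hdet : AnalyticOnNhd ℝ (fun x => (T x).det) U := by
    simp only [Matrix.det_apply']
    refine Finset.analyticOnNhd_fun_sum _ fun σ _ => ?_
    refine AnalyticOnNhd.mul analyticOnNhd_const ?_
    exact Finset.analyticOnNhd_fun_prod _ fun i _ => hT _ _
  have h0 : (T x₀).det ≠ 0 := by
    have hid : (ContinuousLinearMap.id ℝ V).toLinearMap = LinearMap.id := rfl
    simp only [T, hR, hid, LinearMap.toMatrix_id, Matrix.det_one]
    exact one_ne_zero
  filter_upwards [ae_ne_zero_of_analyticOnNhd μ hU hUc hdet hx₀ h0] with x hx hxU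
  have h2 := hx hxU
  have h3 : LinearMap.det ((fderiv ℝ F x).comp R).toLinearMap ≠ 0 := by
    rwa [← LinearMap.det_toMatrix b]
  have h5 : Function.Surjective (fderiv ℝ F x ∘ R) := (LinearMap.equivOfDetNeZero _ h3).surjective
  exact Function.Surjective.of_comp h5

theorem measure_inter_preimage_eq_zero [MeasurableSpace V] [BorelSpace V]
    (μ : Measure E) [μ.IsAddHaarMeasure]
    (ν : Measure V) [ν.IsAddHaarMeasure] {F : E → V} {U : Set E}
    (hU : IsOpen U) (hUc : Convex ℝ U) (hF : AnalyticOnNhd ℝ F U) {x₀ : E} (hx₀ : x₀ ∈ U)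
    (hsurj : Function.Surjective (fderiv ℝ F x₀)) {N : Set V} (hN : ν N = 0) :
    μ (U ∩ F ⁻¹' N) = 0 := by
  have hcrit := ae_surjective_fderiv μ hU hUc hF hx₀ hsurj
  have hreg : μ {x | x ∈ U ∧ Function.Surjective (fderiv ℝ F x) ∧ F x ∈ N} = 0 := by
    refine measure_null_of_locally_null _ fun x hx => ?_
    obtain ⟨u, hu, hu0⟩ := exists_mem_nhds_measure_inter_preimage_eq_zero μ ν
      (hF x hx.1).contDiffAt (hF x hx.1).differentiableAt.hasFDerivAt hx.2.1 hN
    exact ⟨_, inter_mem (mem_nhdsWithin_of_mem_nhds hu) self_mem_nhdsWithin,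
      measure_mono_null (by rintro y ⟨hy, -, -, hyN⟩; exact ⟨hy, hyN⟩) hu0⟩
  rw [ae_iff] at hcrit
  refine measure_mono_null (t := _ ∪ _) ?_ (measure_union_null hcrit hreg)
  rintro x ⟨hxU, hxN⟩
  by_cases hs : Function.Surjective (fderiv ℝ F x)
  · exact Or.inr ⟨hxU, hs, hxN⟩
  · exact Or.inl fun h => hs (h hxU)

theorem frequently_surjective_fderiv {F : E → V} {U : Set E}
    (hU : IsOpen U) (hUc : Convex ℝ U) (hF : AnalyticOnNhd ℝ F U) {x₀ : E} (hx₀ : x₀ ∈ U)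
    (hsurj : Function.Surjective (fderiv ℝ F x₀)) {y : E} (hy : y ∈ U) :
    ∃ᶠ x in 𝓝 y, Function.Surjective (fderiv ℝ F x) := by
  intro hcon
  have h := ae_surjective_fderiv (Measure.addHaar : Measure E) hU hUc hF hx₀ hsurj
  have h1 := Measure.measure_pos_of_mem_nhds (Measure.addHaar : Measure E)
    (inter_mem hcon (hU.mem_nhds hy))
  rw [ae_iff] at h
  exact h1.ne' (measure_mono_null (by rintro x ⟨hx, hxU⟩ h'; exact hx (h' hxU)) h)

end Submersion

/-! ### Local parametrizations and tangent spaces -/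

/-- A real-analytic parametrization of the part of the `d`-dimensional submanifold `M` which lies
in the open set `domain`: the map `toFun` from a convex open subset `source` of a linear subspace
`W`, together with its inverse `coord` on `M ∩ domain`. The map `coord` is defined on the whole
ambient space, and is differentiable on `domain`, so that it can be composed with curves in `M`. -/
structure LocalParametrization {n : ℕ} (d : ℕ) (M : Set (PhaseSpace n)) where
  W : Submodule ℝ (PhaseSpace n)
  toFun : W → PhaseSpace n
  coord : PhaseSpace n → W
  source : Set W
  domain : Set (PhaseSpace n)
  isOpen_source : IsOpen source
  convex_source : Convex ℝ source
  isOpen_domain : IsOpen domain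
  analytic : AnalyticOnNhd ℝ toFun source
  differentiable_coord : DifferentiableOn ℝ coord domain
  measurable_coord : Measurable coord
  toFun_mem_domain : ∀ u ∈ source, toFun u ∈ domain
  toFun_mem : ∀ u ∈ source, toFun u ∈ M
  coord_mem : ∀ x ∈ domain, x ∈ M → coord x ∈ source
  toFun_coord : ∀ x ∈ domain, x ∈ M → toFun (coord x) = x
  coord_toFun : ∀ u ∈ source, coord (toFun u) = u
  /-- The coordinates pull Lebesgue null sets back to null sets for the surface measure. -/
  measure_preimage : ∀ N : Set W, MeasurableSet N → volume N = 0 →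
    inducedMeasure d M (domain ∩ coord ⁻¹' N) = 0

/-- Lipschitz maps defined on a `d`-dimensional subspace send Lebesgue null sets to null sets for
the `d`-dimensional Hausdorff measure. -/
theorem euclideanHausdorffMeasure_eq_zero_of_subset_image {n d : ℕ}
    {W : Submodule ℝ (PhaseSpace n)} (hW : Module.finrank ℝ W = d)
    {f : PhaseSpace n → PhaseSpace n} {L : NNReal} {B N : Set W}
    (hf : LipschitzOnWith L f (Subtype.val '' B)) (hN : volume N = 0)
    {S : Set (PhaseSpace n)} (hS : S ⊆ (fun u : W => f u) '' (N ∩ B)) :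
    (Measure.euclideanHausdorffMeasure d : Measure (PhaseSpace n)) S = 0 := by
  have hNd : (Measure.hausdorffMeasure d : Measure W) N = 0 := by
    rw [← InnerProductSpace.euclideanHausdorffMeasure_eq_volume, hW,
      Measure.euclideanHausdorffMeasure_def, Measure.smul_apply, ENNReal.smul_def,
      smul_eq_mul] at hN
    refine (mul_eq_zero.1 hN).resolve_left ?_
    simpa using Measure.addHaarScalarFactor_volume_hausdorffMeasure_ne_zero d
  have hiso : Isometry (Subtype.val : W → PhaseSpace n) := isometry_subtype_coe
  have hzero : (Measure.hausdorffMeasure d : Measure (PhaseSpace n))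
      (f '' (Subtype.val '' (N ∩ B))) = 0 := by
    have h := (hf.mono (Set.image_mono (Set.inter_subset_right (s := N)))).hausdorffMeasure_image_le
      (d := d) (by positivity)
    rw [hiso.hausdorffMeasure_image (Or.inl (by positivity)),
      measure_mono_null Set.inter_subset_left hNd, mul_zero] at h
    exact le_antisymm h zero_le
  rw [Set.image_image] at hzero
  rw [Measure.euclideanHausdorffMeasure_def, Measure.smul_apply, measure_mono_null hS hzero,
    smul_zero]

/-- The inverse of a straightening chart, restricted to the linear subspace to which it carries
`M`, is a local parametrization; composing the chart with the orthogonal projection to this subspace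
gives the coordinates. -/
theorem exists_localParametrization {n d : ℕ} {M : Set (PhaseSpace n)}
    (hM : IsAnalyticSubmanifold d M) {p : PhaseSpace n} (hp : p ∈ M) :
    ∃ c : LocalParametrization d M, p ∈ c.domain := by
  classical
  obtain ⟨Φ, W, hpΦ, hΦ, hsymm, hW, himg⟩ := hM p hp
  have hpt : Φ p ∈ Φ.target := Φ.map_source hpΦ
  obtain ⟨L, t, ht, hL⟩ := ((hsymm (Φ p) hpt).contDiffAt (n := 1)).exists_lipschitzOnWith
  obtain ⟨r, hr, hrt⟩ := Metric.mem_nhds_iff.1 (inter_mem ht (Φ.open_target.mem_nhds hpt))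
  let O : Set (PhaseSpace n) := Φ.source ∩ Φ ⁻¹' Metric.ball (Φ p) r
  have hO : IsOpen O := Φ.isOpen_inter_preimage Metric.isOpen_ball
  obtain ⟨π, hπm, hπO⟩ : ∃ π : PhaseSpace n → W, Measurable π ∧
      Set.EqOn π (fun x => W.orthogonalProjectionOnto (Φ x)) O := by
    have h1 : ContinuousOn (fun x => W.orthogonalProjectionOnto (Φ x)) O :=
      W.orthogonalProjectionOnto.continuous.comp_continuousOn
        (hΦ.continuousOn.mono Set.inter_subset_left)
    exact ⟨O.piecewise (fun x => W.orthogonalProjectionOnto (Φ x)) 0,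
      h1.measurable_piecewise continuousOn_const hO.measurableSet, Set.piecewise_eqOn _ _ _⟩
  let B : Set W := W.subtypeL ⁻¹' Metric.ball (Φ p) r
  have hBt : ∀ u ∈ B, (u : PhaseSpace n) ∈ Φ.target := fun u hu => (hrt hu).2
  have hΦM : ∀ x ∈ O, x ∈ M → (π x : PhaseSpace n) = Φ x := by
    intro x hx hxM
    rw [hπO hx]
    exact Submodule.starProjection_eq_self_iff.2 ((himg hx.1).2 hxM)
  have hdiff : DifferentiableOn ℝ π O := by
    have h1 : DifferentiableOn ℝ (fun x => W.orthogonalProjectionOnto (Φ x)) O :=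
      W.orthogonalProjectionOnto.differentiable.comp_differentiableOn
        (hΦ.differentiableOn.mono Set.inter_subset_left)
    exact h1.congr hπO
  have hsrc : ∀ u ∈ B, Φ.symm u ∈ O := fun u hu =>
    ⟨Φ.map_target (hBt u hu), by
      change Φ (Φ.symm u) ∈ Metric.ball (Φ p) r
      rw [Φ.right_inv (hBt u hu)]
      exact hu⟩
  have hMem : ∀ u ∈ B, Φ.symm u ∈ M := fun u hu => by
    have h := himg (Φ.map_target (hBt u hu))
    rw [Φ.right_inv (hBt u hu)] at h
    exact h.1 u.2
  have hBo : IsOpen B := Metric.isOpen_ball.preimage W.subtypeL.continuous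
  have hBc : Convex ℝ B := (convex_ball _ _).linear_preimage W.subtype
  have han : AnalyticOnNhd ℝ (fun u : W => Φ.symm u) B := fun u hu =>
    AnalyticAt.comp (f := fun u : W => (u : PhaseSpace n)) (hsymm u (hBt u hu))
      (W.subtypeL.analyticAt u)
  have hπB : ∀ x ∈ O, x ∈ M → π x ∈ B := by
    intro x hx hxM
    change (π x : PhaseSpace n) ∈ Metric.ball (Φ p) r
    rw [hΦM x hx hxM]
    exact hx.2
  have hright : ∀ x ∈ O, x ∈ M → Φ.symm (π x : PhaseSpace n) = x := by
    intro x hx hxM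
    rw [hΦM x hx hxM, Φ.left_inv hx.1]
  have hleft : ∀ u ∈ B, π (Φ.symm u) = u := by
    intro u hu
    have h := hΦM _ (hsrc u hu) (hMem u hu)
    rw [Φ.right_inv (hBt u hu)] at h
    exact Subtype.ext h
  have hnull : ∀ N : Set W, MeasurableSet N → volume N = 0 →
      inducedMeasure d M (O ∩ π ⁻¹' N) = 0 := by
    intro N hNm hN
    rw [inducedMeasure, Measure.restrict_apply (hO.measurableSet.inter (hπm hNm))]
    refine euclideanHausdorffMeasure_eq_zero_of_subset_image hW (hL.mono ?_) hN ?_ (B := B)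
    · rintro _ ⟨x, hx, rfl⟩
      exact (hrt hx).1
    · rintro x ⟨⟨hx, hxN⟩, hxM⟩
      exact ⟨π x, ⟨hxN, hπB x hx hxM⟩, hright x hx hxM⟩
  have hpb : Φ p ∈ Metric.ball (Φ p) r := Metric.mem_ball_self hr
  have hpO : p ∈ O := ⟨hpΦ, hpb⟩
  exact ⟨{
    W := W
    toFun := fun u => Φ.symm u
    coord := π
    source := B
    domain := O
    isOpen_source := hBo
    convex_source := hBc
    isOpen_domain := hO
    analytic := han
    differentiable_coord := hdiff
    measurable_coord := hπm
    toFun_mem_domain := hsrc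
    toFun_mem := hMem
    coord_mem := hπB
    toFun_coord := hright
    coord_toFun := hleft
    measure_preimage := hnull }, hpO⟩

namespace LocalParametrization

variable {n d : ℕ} {M : Set (PhaseSpace n)} (c : LocalParametrization d M)

/-- The velocities of curves in `M` are the images of vectors under the derivative of a
parametrization. -/
theorem range_fderiv {u : c.W} (hu : u ∈ c.source) :
    LinearMap.range (fderiv ℝ c.toFun u).toLinearMap = tangentSpaceAt M (c.toFun u) := by
  apply le_antisymm
  · rintro _ ⟨w, rfl⟩
    refine Submodule.subset_span ⟨fun t => c.toFun (u + t • w), ?_, ?_, by simp, ?_⟩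
    · refine ContDiffAt.comp (g := c.toFun) (0 : ℝ) ?_ (by fun_prop)
      simpa using (c.analytic u hu).contDiffAt
    · have h : Tendsto (fun t : ℝ => u + t • w) (𝓝 0) (𝓝 u) := by
        have : Continuous fun t : ℝ => u + t • w := by fun_prop
        simpa using this.tendsto 0
      exact (h.eventually (c.isOpen_source.mem_nhds hu)).mono fun t ht => c.toFun_mem _ ht
    · have h1 : HasDerivAt (fun t : ℝ => u + t • w) w 0 := by
        simpa using ((hasDerivAt_id (0 : ℝ)).smul_const w).const_add u
      have h2 : HasFDerivAt c.toFun (fderiv ℝ c.toFun u) (u + (0 : ℝ) • w) := by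
        simpa using (c.analytic u hu).differentiableAt.hasFDerivAt
      exact (h2.comp_hasDerivAt (0 : ℝ) h1).deriv
  · refine Submodule.span_le.2 ?_
    rintro v ⟨γ, hγ, hγM, h0, rfl⟩
    have hdom : γ 0 ∈ c.domain := h0 ▸ c.toFun_mem_domain u hu
    have hc : c.coord (γ 0) = u := by rw [h0, c.coord_toFun u hu]
    have hγd : HasDerivAt γ (deriv γ 0) 0 := (hγ.differentiableAt (by simp)).hasDerivAt
    have hcd := (c.differentiable_coord.differentiableAt
      (c.isOpen_domain.mem_nhds hdom)).hasFDerivAt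
    have hfd : HasFDerivAt c.toFun (fderiv ℝ c.toFun u) (c.coord (γ 0)) := by
      rw [hc]
      exact (c.analytic u hu).differentiableAt.hasFDerivAt
    have h1 := hfd.comp_hasDerivAt (0 : ℝ) (hcd.comp_hasDerivAt (0 : ℝ) hγd)
    have h2 : γ =ᶠ[𝓝 0] c.toFun ∘ c.coord ∘ γ := by
      filter_upwards [hγM, hγ.continuousAt (c.isOpen_domain.mem_nhds hdom)] with t ht ht'
      exact (c.toFun_coord _ ht' ht).symm
    exact ⟨_, ((h1.congr_of_eventuallyEq h2).deriv).symm⟩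

end LocalParametrization

/-! ### The sum map in coordinates -/

section Sum

variable {ι : Type*} [Fintype ι] {E : ι → Type*} [∀ i, NormedAddCommGroup (E i)]
  [∀ i, NormedSpace ℝ (E i)] {V : Type*} [NormedAddCommGroup V] [NormedSpace ℝ V]
  {f : ∀ i, E i → V}

theorem hasFDerivAt_sum_apply {f' : ∀ i, E i →L[ℝ] V} {u : ∀ i, E i}
    (hf : ∀ i, HasFDerivAt (f i) (f' i) (u i)) :
    HasFDerivAt (fun u : ∀ i, E i => ∑ i, f i (u i))
      (∑ i, f' i ∘SL ContinuousLinearMap.proj i) u :=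
  HasFDerivAt.fun_sum fun i _ => (hf i).comp u (hasFDerivAt_apply i u)

theorem analyticOnNhd_sum_apply {s : ∀ i, Set (E i)} (hf : ∀ i, AnalyticOnNhd ℝ (f i) (s i)) :
    AnalyticOnNhd ℝ (fun u : ∀ i, E i => ∑ i, f i (u i)) (Set.univ.pi s) := by
  refine Finset.analyticOnNhd_fun_sum _ fun i _ u hu => ?_
  exact AnalyticAt.comp (f := fun u : ∀ i, E i => u i) (hf i (u i) (hu i trivial))
    (ContinuousLinearMap.analyticAt (ContinuousLinearMap.proj (R := ℝ) (φ := E) i) u)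

theorem range_sum_comp_proj [DecidableEq ι] (f' : ∀ i, E i →L[ℝ] V) :
    LinearMap.range (∑ i, f' i ∘SL ContinuousLinearMap.proj i : (∀ i, E i) →L[ℝ] V).toLinearMap =
      ⨆ i, LinearMap.range (f' i).toLinearMap := by
  apply le_antisymm
  · rintro _ ⟨w, rfl⟩
    simp only [ContinuousLinearMap.coe_coe, sum_apply,
      ContinuousLinearMap.comp_apply, ContinuousLinearMap.proj_apply]
    exact Submodule.sum_mem _ fun i _ =>
      Submodule.mem_iSup_of_mem (p := fun i => LinearMap.range (f' i).toLinearMap) i ⟨w i, rfl⟩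
  · refine iSup_le fun i => ?_
    rintro _ ⟨w, rfl⟩
    refine ⟨Pi.single i w, ?_⟩
    simp only [ContinuousLinearMap.coe_coe, sum_apply,
      ContinuousLinearMap.comp_apply, ContinuousLinearMap.proj_apply]
    rw [Finset.sum_eq_single i (fun j _ hj => by simp [Pi.single_eq_of_ne hj]) (by simp)]
    simp

end Sum

section Product

variable {n k : ℕ} {d : Fin k → ℕ} {M : Fin k → Set (PhaseSpace n)}
  (c : ∀ i, LocalParametrization (d i) (M i))

/-- The sum map on the product of `k` submanifolds, read in local parametrizations of them. -/
noncomputable def sumMap (u : ∀ i, (c i).W) : PhaseSpace n := ∑ i, (c i).toFun (u i)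

theorem analyticOnNhd_sumMap :
    AnalyticOnNhd ℝ (sumMap c) (Set.univ.pi fun i => (c i).source) :=
  analyticOnNhd_sum_apply fun i => (c i).analytic

theorem surjective_fderiv_sumMap_iff {u : ∀ i, (c i).W}
    (hu : u ∈ Set.univ.pi fun i => (c i).source) :
    Function.Surjective (fderiv ℝ (sumMap c) u) ↔
      ⨆ i, tangentSpaceAt (M i) ((c i).toFun (u i)) = ⊤ := by
  have h := hasFDerivAt_sum_apply (f := fun i => (c i).toFun) (u := u) fun i =>
    ((c i).analytic (u i) (hu i trivial)).differentiableAt.hasFDerivAt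
  have hsup : LinearMap.range (fderiv ℝ (sumMap c) u).toLinearMap =
      ⨆ i, tangentSpaceAt (M i) ((c i).toFun (u i)) := by
    simp only [← fun i => (c i).range_fderiv (hu i trivial)]
    exact (congrArg (fun L : (∀ i, (c i).W) →L[ℝ] PhaseSpace n => LinearMap.range L.toLinearMap)
      h.fderiv).trans (range_sum_comp_proj _)
  rw [← hsup]
  exact LinearMap.range_eq_top.symm

theorem coord_mem_pi_source {x : Fin k → PhaseSpace n} (hx : ∀ i, x i ∈ (c i).domain)
    (hxM : x ∈ Set.univ.pi M) :
    (fun i => (c i).coord (x i)) ∈ Set.univ.pi fun i => (c i).source :=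
  fun i _ => (c i).coord_mem _ (hx i) (hxM i trivial)

theorem surjective_fderiv_sumMap_coord {x : Fin k → PhaseSpace n}
    (hx : ∀ i, x i ∈ (c i).domain) (hxM : x ∈ Set.univ.pi M)
    (hspan : ⨆ i, tangentSpaceAt (M i) (x i) = ⊤) :
    Function.Surjective (fderiv ℝ (sumMap c) fun i => (c i).coord (x i)) := by
  rw [surjective_fderiv_sumMap_iff c (coord_mem_pi_source c hx hxM), ← hspan]
  exact iSup_congr fun i => by rw [(c i).toFun_coord _ (hx i) (hxM i trivial)]

theorem isOpen_pi_source : IsOpen (Set.univ.pi fun i => (c i).source) :=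
  isOpen_set_pi Set.finite_univ fun i _ => (c i).isOpen_source

theorem convex_pi_source : Convex ℝ (Set.univ.pi fun i => (c i).source) :=
  convex_pi fun i _ => (c i).convex_source

/-- Within the range of a fixed choice of parametrizations, if the tangent spaces span the whole
space at one point of the product of the submanifolds, then they do so on a dense set of points. -/
theorem frequently_iSup_tangentSpaceAt_eq_top {x y : Fin k → PhaseSpace n}
    (hx : ∀ i, x i ∈ (c i).domain) (hxM : x ∈ Set.univ.pi M)
    (hspan : ⨆ i, tangentSpaceAt (M i) (x i) = ⊤)
    (hy : ∀ i, y i ∈ (c i).domain) (hyM : y ∈ Set.univ.pi M) :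
    ∃ᶠ z in 𝓝[Set.univ.pi M] y, ⨆ i, tangentSpaceAt (M i) (z i) = ⊤ := by
  have hv := coord_mem_pi_source c hy hyM
  have hB := (isOpen_pi_source c).mem_nhds hv
  have h1 := frequently_surjective_fderiv (isOpen_pi_source c) (convex_pi_source c)
    (analyticOnNhd_sumMap c) (coord_mem_pi_source c hx hxM)
    (surjective_fderiv_sumMap_coord c hx hxM hspan) hv
  have ht : Tendsto (fun (u : ∀ i, (c i).W) i => (c i).toFun (u i))
      (𝓝 fun i => (c i).coord (y i)) (𝓝[Set.univ.pi M] y) := by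
    refine tendsto_nhdsWithin_iff.2 ⟨tendsto_pi_nhds.2 fun i => ?_, ?_⟩
    · have h2 := ((c i).analytic _ (hv i trivial)).continuousAt.tendsto
      rw [(c i).toFun_coord _ (hy i) (hyM i trivial)] at h2
      exact h2.comp ((continuous_apply i).tendsto _)
    · filter_upwards [hB] with u hu i _
      exact (c i).toFun_mem _ (hu i trivial)
  refine ht.frequently ((h1.and_eventually hB).mono fun u hu => ?_)
  exact (surjective_fderiv_sumMap_iff c hu.2).1 hu.1

end Product

/-! ### Null sets of the product of the surface measures -/

theorem pi_absolutelyContinuous : ∀ {k : ℕ} {α : Fin k → Type*} [∀ i, MeasurableSpace (α i)]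
    (μ ν : ∀ i, Measure (α i)) [∀ i, SigmaFinite (μ i)] [∀ i, SigmaFinite (ν i)],
    (∀ i, μ i ≪ ν i) → Measure.pi μ ≪ Measure.pi ν
  | 0, _, _, μ, ν, _, _, _ => by
    rw [Measure.pi_of_empty μ finZeroElim, Measure.pi_of_empty ν finZeroElim]
  | k + 1, α, _, μ, ν, _, _, h => by
    have h1 := (measurePreserving_piFinSuccAbove μ 0).symm
    have h2 := (measurePreserving_piFinSuccAbove ν 0).symm
    rw [← h1.map_eq, ← h2.map_eq]
    exact ((h 0).prod (pi_absolutelyContinuous (fun j => μ (Fin.succAbove 0 j))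
      (fun j => ν (Fin.succAbove 0 j)) fun j => h _)).map
      (MeasurableEquiv.piFinSuccAbove α 0).symm.measurable

section NullSets

variable {n k : ℕ} {d : Fin k → ℕ} {M : Fin k → Set (PhaseSpace n)}
  (c : ∀ i, LocalParametrization (d i) (M i))

theorem quasiMeasurePreserving_coord (ρ : Fin k → Measure (PhaseSpace n))
    [∀ i, IsFiniteMeasure (ρ i)] (hρ : ∀ i, ρ i ≪ inducedMeasure (d i) (M i)) :
    Measure.QuasiMeasurePreserving (fun (x : Fin k → PhaseSpace n) i => (c i).coord (x i))
      ((Measure.pi ρ).restrict (Set.univ.pi fun i => (c i).domain)) volume := by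
  refine ⟨measurable_pi_lambda _ fun i => (c i).measurable_coord.comp (measurable_pi_apply i), ?_⟩
  rw [Measure.restrict_pi_pi, Measure.pi_map_pi fun i => (c i).measurable_coord.aemeasurable]
  refine pi_absolutelyContinuous _ _ fun i => Measure.AbsolutelyContinuous.mk fun N hN hN0 => ?_
  rw [Measure.map_apply (c i).measurable_coord hN,
    Measure.restrict_apply ((c i).measurable_coord hN), Set.inter_comm]
  exact hρ i ((c i).measure_preimage N hN hN0)

/-- In the range of a fixed choice of parametrizations, if the tangent spaces span at one point `x`,
the tuples of points of the submanifolds whose sum lies in a given Lebesgue null set are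
negligible. -/
theorem measure_pi_domain_inter_eq_zero (ρ : Fin k → Measure (PhaseSpace n))
    [∀ i, IsFiniteMeasure (ρ i)] (hρ : ∀ i, ρ i ≪ inducedMeasure (d i) (M i))
    {x : Fin k → PhaseSpace n} (hx : ∀ i, x i ∈ (c i).domain) (hxM : x ∈ Set.univ.pi M)
    (hspan : ⨆ i, tangentSpaceAt (M i) (x i) = ⊤)
    {N : Set (PhaseSpace n)} (hN : volume N = 0) :
    Measure.pi ρ ((Set.univ.pi fun i => (c i).domain) ∩
      (Set.univ.pi M ∩ {y | ∑ i, y i ∈ N})) = 0 := by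
  have h := measure_inter_preimage_eq_zero (volume : Measure (∀ i, (c i).W)) volume
    (isOpen_pi_source c) (convex_pi_source c) (analyticOnNhd_sumMap c)
    (coord_mem_pi_source c hx hxM) (surjective_fderiv_sumMap_coord c hx hxM hspan) hN
  have h1 := (quasiMeasurePreserving_coord c ρ hρ).preimage_null h
  have hO : MeasurableSet (Set.univ.pi fun i => (c i).domain) :=
    (isOpen_set_pi Set.finite_univ fun i _ => (c i).isOpen_domain).measurableSet
  rw [Measure.restrict_apply' hO] at h1
  refine measure_mono_null ?_ h1
  rintro y ⟨hy, hyM, hyN⟩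
  refine ⟨⟨coord_mem_pi_source c (fun i => hy i trivial) hyM, ?_⟩, hy⟩
  have h2 : sumMap c (fun i => (c i).coord (y i)) = ∑ i, y i :=
    Finset.sum_congr rfl fun i _ => (c i).toFun_coord _ (hy i trivial) (hyM i trivial)
  change sumMap c (fun i => (c i).coord (y i)) ∈ N
  rw [h2]
  exact hyN

/-- The spanning condition at a single point propagates along the connected product of the
submanifolds: the set of points near which it holds frequently is open and closed. -/
theorem frequently_iSup_tangentSpaceAt_eq_top_of_isConnected
    (hM : ∀ i, IsAnalyticSubmanifold (d i) (M i)) (hconn : ∀ i, IsConnected (M i))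
    (hspan : ∃ p : Fin k → PhaseSpace n,
      (∀ i, p i ∈ M i) ∧ ⨆ i, tangentSpaceAt (M i) (p i) = ⊤)
    {x : Fin k → PhaseSpace n} (hx : x ∈ Set.univ.pi M) :
    ∃ᶠ z in 𝓝[Set.univ.pi M] x, ⨆ i, tangentSpaceAt (M i) (z i) = ⊤ := by
  obtain ⟨p, hp, hpspan⟩ := hspan
  have hpM : p ∈ Set.univ.pi M := fun i _ => hp i
  let Q : (Fin k → PhaseSpace n) → Prop := fun x =>
    ∃ᶠ z in 𝓝[Set.univ.pi M] x, ⨆ i, tangentSpaceAt (M i) (z i) = ⊤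
  have hQp : Q p := by
    intro hcon
    exact (mem_of_mem_nhdsWithin hpM hcon : ¬ _) hpspan
  refine (isPreconnected_univ_pi fun i => (hconn i).isPreconnected).induction₂'
    (fun x y => Q x → Q y) ?_ (fun x y z _ _ _ h1 h2 h => h2 (h1 h)) hpM hx hQp
  intro x hx
  choose c hc using fun i => exists_localParametrization (hM i) (hx i trivial)
  have hO : IsOpen (Set.univ.pi fun i => (c i).domain) :=
    isOpen_set_pi Set.finite_univ fun i _ => (c i).isOpen_domain
  have hOQ : ∀ y ∈ Set.univ.pi fun i => (c i).domain, Q y →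
      ∀ z ∈ Set.univ.pi fun i => (c i).domain, z ∈ Set.univ.pi M → Q z := by
    intro y hy hQ z hz hzM
    obtain ⟨w, hw, hwO, hwM⟩ := (hQ.and_eventually (inter_mem
      (mem_nhdsWithin_of_mem_nhds (hO.mem_nhds hy)) self_mem_nhdsWithin)).exists
    exact frequently_iSup_tangentSpaceAt_eq_top c (fun i => hwO i trivial) hwM hw
      (fun i => hz i trivial) hzM
  have hxO : x ∈ Set.univ.pi fun i => (c i).domain := fun i _ => hc i
  filter_upwards [mem_nhdsWithin_of_mem_nhds (hO.mem_nhds hxO), self_mem_nhdsWithin] with y hy hyM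
  exact ⟨fun h => hOQ x hxO h y hy hyM, fun h => hOQ y hy h x hxO hx⟩

theorem measure_pi_sum_mem_eq_zero
    (hM : ∀ i, IsAnalyticSubmanifold (d i) (M i)) (hconn : ∀ i, IsConnected (M i))
    (hspan : ∃ p : Fin k → PhaseSpace n,
      (∀ i, p i ∈ M i) ∧ ⨆ i, tangentSpaceAt (M i) (p i) = ⊤)
    (ρ : Fin k → Measure (PhaseSpace n)) [∀ i, IsFiniteMeasure (ρ i)]
    (hρ : ∀ i, ρ i ≪ inducedMeasure (d i) (M i)) (hρM : ∀ i, ρ i (M i)ᶜ = 0)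
    {N : Set (PhaseSpace n)} (hN : volume N = 0) :
    Measure.pi ρ {y | ∑ i, y i ∈ N} = 0 := by
  have h1 : Measure.pi ρ (Set.univ.pi M ∩ {y | ∑ i, y i ∈ N}) = 0 := by
    refine measure_null_of_locally_null _ fun x hx => ?_
    choose c hc using fun i => exists_localParametrization (hM i) (hx.1 i trivial)
    have hO : IsOpen (Set.univ.pi fun i => (c i).domain) :=
      isOpen_set_pi Set.finite_univ fun i _ => (c i).isOpen_domain
    have hxO : x ∈ Set.univ.pi fun i => (c i).domain := fun i _ => hc i
    obtain ⟨w, hw, hwO, hwM⟩ :=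
      ((frequently_iSup_tangentSpaceAt_eq_top_of_isConnected hM hconn hspan hx.1).and_eventually
        (inter_mem (mem_nhdsWithin_of_mem_nhds (hO.mem_nhds hxO)) self_mem_nhdsWithin)).exists
    exact ⟨_, inter_mem (mem_nhdsWithin_of_mem_nhds (hO.mem_nhds hxO)) self_mem_nhdsWithin,
      measure_pi_domain_inter_eq_zero c ρ hρ (fun i => hwO i trivial) hwM hw hN⟩
  have h2 : Measure.pi ρ (⋃ i, Function.eval i ⁻¹' (M i)ᶜ) = 0 :=
    measure_iUnion_null fun i => Measure.pi_eval_preimage_null ρ (hρM i)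
  refine measure_mono_null (fun y hy => ?_) (measure_union_null h1 h2)
  by_cases hyM : y ∈ Set.univ.pi M
  · exact Or.inl ⟨hyM, hy⟩
  · obtain ⟨i, hi⟩ : ∃ i, y i ∉ M i := by simpa [Set.mem_pi] using hyM
    exact Or.inr (Set.mem_iUnion.2 ⟨i, hi⟩)

end NullSets

/-! ### Domination of the twisted convolution -/

section Domination

variable {n : ℕ}

theorem variation_absolutelyContinuous {X : Type*} [MeasurableSpace X] {μ : ComplexMeasure X}
    {ρ : Measure X} (h : ∀ A, MeasurableSet A → ρ A = 0 → μ A = 0) : μ.variation ≪ ρ := by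
  refine Measure.AbsolutelyContinuous.mk fun A hA hA0 => ?_
  rw [VectorMeasure.variation_apply_eq_zero hA]
  intro B hBA hB
  exact h B hB (measure_mono_null hBA hA0)

/-- If `ρ` and `τ` dominate `μ` and `ν`, then the ordinary convolution of `ρ` and `τ` dominates
`μ ♮ ν`: the phase factor plays no role for null sets. -/
theorem twistedConv_apply_eq_zero {μ ν : ComplexMeasure (PhaseSpace n)}
    {ρ τ : Measure (PhaseSpace n)} [SFinite ρ]
    (hμ : ∀ A, MeasurableSet A → ρ A = 0 → μ A = 0)
    (hν : ∀ A, MeasurableSet A → τ A = 0 → ν A = 0)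
    {A : Set (PhaseSpace n)} (hA : MeasurableSet A)
    (h : (τ.prod ρ) {z | z.2 + z.1 ∈ A} = 0) : twistedConv μ ν A = 0 := by
  have hm : Measurable fun z : PhaseSpace n × PhaseSpace n => z.2 + z.1 := by fun_prop
  have h1 := (variation_absolutelyContinuous hν).ae_le (Measure.measure_ae_null_of_prod_null h)
  rw [twistedConv_eq_twistedPush, twistedPush_apply μ ν hA]
  refine VectorMeasure.integral_eq_zero_of_ae ?_
  filter_upwards [h1] with q hq
  refine VectorMeasure.integral_eq_zero_of_ae ?_
  have h2 : ∀ᵐ p ∂ρ, p + q ∉ A := by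
    rw [ae_iff]
    simpa using hq
  filter_upwards [(variation_absolutelyContinuous hμ).ae_le h2] with p hp
  simp [hp]

/-- If the measures `ρ i` dominate the `μ i`, then the law of `∑ i, y i` under the product of the
`ρ i` dominates the iterated twisted convolution of the `μ i`. -/
theorem iterTwistedConv_apply_eq_zero : ∀ {k : ℕ} {μ : Fin (k + 1) → ComplexMeasure (PhaseSpace n)}
    {ρ : Fin (k + 1) → Measure (PhaseSpace n)} [∀ i, IsFiniteMeasure (ρ i)]
    (_ : ∀ i A, MeasurableSet A → ρ i A = 0 → μ i A = 0)
    {A : Set (PhaseSpace n)} (_ : MeasurableSet A)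
    (_ : Measure.pi ρ {y | ∑ i, y i ∈ A} = 0), iterTwistedConv k μ A = 0
  | 0, μ, ρ, _, hμ, A, hA, h => by
    refine hμ 0 A hA ?_
    let _ : Unique (Fin (0 + 1)) := inferInstanceAs (Unique (Fin 1))
    have h1 := (measurePreserving_piUnique ρ).measure_preimage hA.nullMeasurableSet
    have h2 : MeasurableEquiv.piUnique (fun _ : Fin (0 + 1) => PhaseSpace n) ⁻¹' A =
        {y | ∑ i, y i ∈ A} := by
      ext y
      simp [MeasurableEquiv.piUnique]
    rw [h2, h] at h1
    exact h1.symm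
  | k + 1, μ, ρ, _, hμ, A, hA, h => by
    let P : Measure (Fin (k + 1) → PhaseSpace n) := Measure.pi fun i => ρ i.castSucc
    have hS : Measurable fun y : Fin (k + 1) → PhaseSpace n => ∑ i, y i := by fun_prop
    refine twistedConv_apply_eq_zero (ρ := P.map fun y => ∑ i, y i) (τ := ρ (Fin.last (k + 1)))
      ?_ (hμ _) hA ?_
    · intro B hB hB0
      rw [Measure.map_apply hS hB] at hB0
      exact iterTwistedConv_apply_eq_zero (fun i => hμ i.castSucc) hB hB0
    · have hm : MeasurableSet {z : PhaseSpace n × PhaseSpace n | z.2 + z.1 ∈ A} :=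
        (measurable_snd.add measurable_fst) hA
      have h1 := measurePreserving_piFinSuccAbove ρ (Fin.last (k + 1))
      have hq : Measurable (Prod.map id fun y : Fin (k + 1) → PhaseSpace n => ∑ i, y i :
          PhaseSpace n × (Fin (k + 1) → PhaseSpace n) → PhaseSpace n × PhaseSpace n) :=
        measurable_id.prodMap hS
      have h2 : (ρ (Fin.last (k + 1))).prod (P.map fun y => ∑ i, y i) =
          ((ρ (Fin.last (k + 1))).prod P).map (Prod.map id fun y => ∑ i, y i) := by
        rw [← Measure.map_prod_map _ _ measurable_id hS, Measure.map_id]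
      have hP : P = Measure.pi fun j => ρ ((Fin.last (k + 1)).succAbove j) := by
        simp [P]
      rw [h2, hP, ← h1.map_eq, Measure.map_map hq h1.measurable,
        Measure.map_apply (hq.comp h1.measurable) hm, ← h]
      congr 1
      ext y
      simp [Fin.sum_univ_castSucc, MeasurableEquiv.piFinSuccAbove, Fin.init]

/-- Only the part of `A` in the support of the density matters. -/
theorem withDensityᵥ_apply_eq_zero {d : ℕ} {M : Set (PhaseSpace n)} {ψ : PhaseSpace n → ℂ}
    (hψ : Integrable ψ (inducedMeasure d M)) {A : Set (PhaseSpace n)} (hA : MeasurableSet A)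
    (h : inducedMeasure d M (tsupport ψ ∩ A) = 0) :
    (inducedMeasure d M).withDensityᵥ ψ A = 0 := by
  rw [withDensityᵥ_apply hψ hA]
  refine setIntegral_eq_zero_of_ae_eq_zero ?_
  have h1 : ∀ᵐ x ∂(inducedMeasure d M), x ∉ tsupport ψ ∩ A := by
    rw [ae_iff]; simpa using h
  filter_upwards [h1] with x hx hxA
  by_contra hne
  exact hx ⟨subset_tsupport ψ hne, hxA⟩

/-- A smooth measure on `M` is dominated by the restriction of the surface measure of `M` to the
compact set where the density can be nonzero. -/
theorem IsSmoothMeasureOn.exists_dominating_measure {d : ℕ} {M : Set (PhaseSpace n)}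
    (hM : IsAnalyticSubmanifold d M) {μ : ComplexMeasure (PhaseSpace n)}
    (hμ : IsSmoothMeasureOn d M μ) :
    ∃ ρ : Measure (PhaseSpace n), IsFiniteMeasure ρ ∧ ρ ≪ inducedMeasure d M ∧ ρ Mᶜ = 0 ∧
      ∀ A, MeasurableSet A → ρ A = 0 → μ A = 0 := by
  obtain ⟨ψ, hψ, hc, rfl⟩ := hμ
  refine ⟨(inducedMeasure d M).restrict (tsupport ψ ∩ M), ⟨?_⟩,
    Measure.absolutelyContinuous_of_le Measure.restrict_le_self, ?_, fun A hA h0 => ?_⟩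
  · rw [Measure.restrict_apply_univ]
    exact inducedMeasure_lt_top hM Set.inter_subset_right hc
  · exact measure_mono_null (Set.compl_subset_compl.2 Set.inter_subset_right)
      (mem_ae_iff.1 (ae_restrict_mem hc.measurableSet))
  · refine withDensityᵥ_apply_eq_zero (integrable_density hM hψ hc) hA ?_
    rw [Measure.restrict_apply hA, inducedMeasure,
      Measure.restrict_apply (hA.inter hc.measurableSet)] at h0
    rw [inducedMeasure,
      Measure.restrict_apply ((isClosed_tsupport _).measurableSet.inter hA)]
    refine measure_mono_null ?_ h0
    rintro x ⟨⟨hx, hxA⟩, hxM⟩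
    exact ⟨⟨hxA, hx, hxM⟩, hxM⟩

end Domination

end TwistedRagozin

theorem theorem3p1 (n k : ℕ) (d : Fin (k + 1) → ℕ)
    (M : Fin (k + 1) → Set (TwistedRagozin.PhaseSpace n))
    (hM : ∀ i, TwistedRagozin.IsAnalyticSubmanifold (d i) (M i))
    (hconn : ∀ i, IsConnected (M i))
    (hspan : ∃ p : Fin (k + 1) → TwistedRagozin.PhaseSpace n,
      (∀ i, p i ∈ M i) ∧ ⨆ i, TwistedRagozin.tangentSpaceAt (M i) (p i) = ⊤)
    (μ : Fin (k + 1) → MeasureTheory.ComplexMeasure (TwistedRagozin.PhaseSpace n))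
    (hμ : ∀ i, TwistedRagozin.IsSmoothMeasureOn (d i) (M i) (μ i)) :
    (TwistedRagozin.iterTwistedConv k μ).AbsolutelyContinuous
      (MeasureTheory.volume :
        MeasureTheory.Measure (TwistedRagozin.PhaseSpace n)).toENNRealVectorMeasure := by
  choose ρ hfin hac hρM hdom using fun i => (hμ i).exists_dominating_measure (hM i)
  refine VectorMeasure.AbsolutelyContinuous.mk fun A hA h0 => ?_
  rw [Measure.toENNRealVectorMeasure_apply_measurable hA] at h0
  exact TwistedRagozin.iterTwistedConv_apply_eq_zero hdom hA
    (TwistedRagozin.measure_pi_sum_mem_eq_zero hM hconn hspan ρ hac hρM h0)
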